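/- Let $n\ge 2$, $s\in(0,1]$ and $p\in(0,\infty]$. For a domain (nonempty connected open set) $\Omega\subset\mathbb R^n$ and a real-valued measurable function $u$ on $\Omega$, let $\mathcal D^s_{\rm ball}(u)$ be the set of all nonnegative measurable functions $g$ on $\Omega$ for which there is a set $E\subset\Omega$ of Lebesgue measure zero such that $$|u(x)-u(y)|\le |x-y|^s\,[g(x)+g(y)]$$ for all $x,y\in\Omega\setminus E$ with $|x-y|<\tfrac12\operatorname{dist}(x,\partial\Omega)$ (with $\operatorname{dist}(x,\emptyset)=\infty$). The space $\dot M^{s,p}_{\rm ball}(\Omega)$ consists of all measurable $u$ (functions equal almost everywhere being identified) with $$\|u\|_{\dot M^{s,p}_{\rm ball}(\Omega)}:=\inf_{g\in\mathcal D^s_{\rm ball}(u)}\|g\|_{L^p(\Omega)}<\infty .$$ A domain $\Omega$ is an $\dot M^{s,p}_{\rm ball}$-extension domain if $\dot M^{s,p}_{\rm ball}(\Omega)=\{u|_\Omega: u\in \dot M^{s,p}_{\rm ball}(\mathbb R^n)\}$ and the norm $\|\cdot\|_{\dot M^{s,p}_{\rm ball}(\Omega)}$ is equivalent, on this space, to the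 norm $v\mapsto\inf\{\|u\|_{\dot M^{s,p}_{\rm ball}(\mathbb R^n)}: u\in\dot M^{s,p}_{\rm ball}(\mathbb R^n),\ u|_\Omega=v\}$. Theorem 1.1. If $\Omega\subset\mathbb R^n$, $n\ge2$, is a bounded $\dot M^{s,n/s}_{\rm ball}$-extension domain for some $s\in(0,1]$, then $\Omega$ has the LLC (linear local connectivity) property: there exists a constant $b\in(0,1]$ such that for all $z\in\mathbb R^n$ and $r>0$, (1) any two points of $\Omega\cap B(z,r)$ can be joined by a curve in $\Omega\cap B(z,r/b)$; (2) any two points of $\Omega\setminus B(z,r)$ can be joined by a curve in $\Omega\setminus B(z,br)$. -/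

import Mathlib

open MeasureTheory
open scoped ENNReal NNReal

/-- A domain of `ℝⁿ`: a nonempty connected open set. -/
def IsDomainSet {n : ℕ} (Ω : Set (EuclideanSpace ℝ (Fin n))) : Prop :=
  IsOpen Ω ∧ IsConnected Ω

/-- The class `𝒟ˢ_ball(u)` on `Ω`: nonnegative measurable functions `g` on `Ω` such that, off a null
set `N ⊆ Ω`, one has `|u x - u y| ≤ |x - y| ^ s * (g x + g y)` whenever
`|x - y| < dist(x, ∂Ω) / 2`. The extended distance to the empty set is `∞`, so for `Ω = ℝⁿ` there is
no restriction on `x, y`. -/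
def HajlaszBallGradients {n : ℕ} (Ω : Set (EuclideanSpace ℝ (Fin n))) (s : ℝ)
    (u : EuclideanSpace ℝ (Fin n) → ℝ) : Set (EuclideanSpace ℝ (Fin n) → ℝ) :=
  {g | AEMeasurable g (volume.restrict Ω) ∧ (∀ x ∈ Ω, 0 ≤ g x) ∧
    ∃ N : Set (EuclideanSpace ℝ (Fin n)), N ⊆ Ω ∧ volume N = 0 ∧
      ∀ x ∈ Ω \ N, ∀ y ∈ Ω \ N, edist x y < Metric.infEDist x (frontier Ω) / 2 →
        |u x - u y| ≤ dist x y ^ s * (g x + g y)}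

/-- The (extended) seminorm of the homogeneous space `Ṁ^{s,p}_ball(Ω)`. -/
noncomputable def hajlaszBallNorm {n : ℕ} (Ω : Set (EuclideanSpace ℝ (Fin n))) (s : ℝ) (p : ℝ≥0∞)
    (u : EuclideanSpace ℝ (Fin n) → ℝ) : ℝ≥0∞ :=
  ⨅ g ∈ HajlaszBallGradients Ω s u, eLpNorm g p (volume.restrict Ω)

/-- Membership in `Ṁ^{s,p}_ball(Ω)`; only the values of `u` on `Ω` (up to null sets) matter. -/
def MemHajlaszBall {n : ℕ} (Ω : Set (EuclideanSpace ℝ (Fin n))) (s : ℝ) (p : ℝ≥0∞)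
    (u : EuclideanSpace ℝ (Fin n) → ℝ) : Prop :=
  AEMeasurable u (volume.restrict Ω) ∧ hajlaszBallNorm Ω s p u < ∞

/-- The quotient norm on the restriction space `Ṁ^{s,p}_ball(ℝⁿ)|_Ω`: the infimum of the norms of
all `u ∈ Ṁ^{s,p}_ball(ℝⁿ)` with `u|_Ω = v`, as classes of functions modulo null sets. -/
noncomputable def hajlaszBallRestrictNorm {n : ℕ} (Ω : Set (EuclideanSpace ℝ (Fin n))) (s : ℝ)
    (p : ℝ≥0∞) (v : EuclideanSpace ℝ (Fin n) → ℝ) : ℝ≥0∞ :=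
  ⨅ u : {u : EuclideanSpace ℝ (Fin n) → ℝ //
      MemHajlaszBall Set.univ s p u ∧ u =ᵐ[volume.restrict Ω] v},
    hajlaszBallNorm Set.univ s p u.1

/-- `Ω` is an `Ṁ^{s,p}_ball`-extension domain: `Ω` is a domain and
`Ṁ^{s,p}_ball(Ω) = Ṁ^{s,p}_ball(ℝⁿ)|_Ω` with equivalent norms. -/
def IsHajlaszBallExtensionDomain {n : ℕ} (Ω : Set (EuclideanSpace ℝ (Fin n))) (s : ℝ)
    (p : ℝ≥0∞) : Prop :=
  IsDomainSet Ω ∧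
  (∀ v : EuclideanSpace ℝ (Fin n) → ℝ, MemHajlaszBall Ω s p v ↔
    ∃ u : EuclideanSpace ℝ (Fin n) → ℝ,
      MemHajlaszBall Set.univ s p u ∧ u =ᵐ[volume.restrict Ω] v) ∧
  ∃ C : ℝ≥0, ∀ v : EuclideanSpace ℝ (Fin n) → ℝ, MemHajlaszBall Ω s p v →
    hajlaszBallRestrictNorm Ω s p v ≤ C * hajlaszBallNorm Ω s p v ∧
    hajlaszBallNorm Ω s p v ≤ C * hajlaszBallRestrictNorm Ω s p v

/-- The linear local connectivity (LLC) property. -/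
def HasLLC {n : ℕ} (Ω : Set (EuclideanSpace ℝ (Fin n))) : Prop :=
  ∃ b : ℝ, 0 < b ∧ b ≤ 1 ∧ ∀ (z : EuclideanSpace ℝ (Fin n)) (r : ℝ), 0 < r →
    (∀ x ∈ Ω ∩ Metric.ball z r, ∀ y ∈ Ω ∩ Metric.ball z r,
      JoinedIn (Ω ∩ Metric.ball z (r / b)) x y) ∧
    (∀ x ∈ Ω \ Metric.ball z r, ∀ y ∈ Ω \ Metric.ball z r,
      JoinedIn (Ω \ Metric.ball z (b * r)) x y)

/-! At the critical exponent `p = n / s` the `L^p` norm of a Hajłasz gradient is scale invariant,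
and two estimates pull against each other.

Lower bound (`exists_pos_le_lintegral_rpow_gradient`): on `ℝⁿ`, a function equal to `1` on one open
set and `0` on another, both meeting every sphere `S(z, t)` with `r < t < 2r`, has gradient mass at
least `c > 0`. Chaining along shrinking balls finds, around each point of one of the sets, a ball
whose mass is at least proportional to its radius; a Vitali covering adds these up.

Upper bound (`exists_nat_lintegral_logGradient_rpow_le`): a logarithmic cutoff between radii `ρ` and
`2 ^ K * ρ` has mass of order `K ^ (1 - p)`, which tends to `0` because `p > 1`.

If LLC fails, two points of `Ω` lie in different components of `Ω` inside a large ball, or outside a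
small one. Multiply the cutoff by the indicator of one component. A pair admissible for the ball
gradient is joined by a segment in `Ω`, so a pair split by the component must cross the cutoff
region, and the logarithmic gradient still works. Connectedness of `Ω` makes both components meet
all the required spheres, so extending this function of small norm to `ℝⁿ` contradicts the lower
bound. -/

/-! ### Lower capacity bound: good points, chaining and covering -/

open Metric in
-- Off a null set, some point has `g ^ p` at most its average. Since `s * p = n`, dividing `κ ^ p`
-- by `r ^ n` gives `(κ / r ^ s) ^ p`, so the bound is scale invariant.
theorem exists_rpow_mul_le_of_setLIntegral_ball_le {n : ℕ} {p s κ r : ℝ} (hp : 0 < p)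
    (hsp : s * p = n) (hr : 0 < r) (hκ : 0 ≤ κ) {g : EuclideanSpace ℝ (Fin n) → ℝ}
    (hg : AEMeasurable g volume) {N : Set (EuclideanSpace ℝ (Fin n))} (hN : volume N = 0)
    (x : EuclideanSpace ℝ (Fin n))
    (h : ∫⁻ w in ball x r, ENNReal.ofReal (g w) ^ p ≤
      ENNReal.ofReal (κ ^ p) * volume (ball (0 : EuclideanSpace ℝ (Fin n)) 1)) :
    ∃ a ∈ ball x r, a ∉ N ∧ r ^ s * g a ≤ κ := by
  have hω0 : volume (ball (0 : EuclideanSpace ℝ (Fin n)) 1) ≠ 0 :=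
    (measure_ball_pos _ _ one_pos).ne'
  have hω1 : volume (ball (0 : EuclideanSpace ℝ (Fin n)) 1) ≠ ∞ := measure_ball_lt_top.ne
  have hB : volume (ball x r) = ENNReal.ofReal (r ^ n) *
      volume (ball (0 : EuclideanSpace ℝ (Fin n)) 1) := by
    rw [Measure.addHaar_ball_of_pos _ _ hr, finrank_euclideanSpace_fin]
  have hrn : 0 < r ^ n := pow_pos hr n
  have hfin : ∫⁻ w in ball x r, ENNReal.ofReal (g w) ^ p ≠ ∞ :=
    (h.trans_lt (ENNReal.mul_lt_top ENNReal.ofReal_lt_top hω1.lt_top)).ne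
  have hμ : volume.restrict (ball x r) ≠ 0 := by
    rw [Ne, Measure.restrict_eq_zero]
    exact (measure_ball_pos _ _ hr).ne'
  have hN' : volume.restrict (ball x r) (N ∪ (ball x r)ᶜ) = 0 := by
    refine measure_union_null (Measure.absolutelyContinuous_of_le Measure.restrict_le_self hN) ?_
    rw [Measure.restrict_apply measurableSet_ball.compl, Set.compl_inter_self, measure_empty]
  have : IsFiniteMeasure (volume.restrict (ball x r)) :=
    ⟨by rw [Measure.restrict_apply_univ]; exact measure_ball_lt_top⟩
  obtain ⟨a, ha, hle⟩ := exists_notMem_null_le_laverage hμ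
    ((ENNReal.measurable_ofReal.comp_aemeasurable hg.restrict).pow_const p) hN'
  simp only [Set.mem_union, Set.mem_compl_iff, not_or, not_not] at ha
  refine ⟨a, ha.2, ha.1, ?_⟩
  have hrs : 0 < r ^ s := Real.rpow_pos_of_pos hr s
  have key : ENNReal.ofReal (g a) ^ p ≤ ENNReal.ofReal (κ / r ^ s) ^ p := by
    refine hle.trans ?_
    rw [laverage_eq, Measure.restrict_apply_univ, hB, ENNReal.ofReal_rpow_of_nonneg (by positivity) hp.le,
      Real.div_rpow hκ hrs.le, ← Real.rpow_mul hr.le, hsp, Real.rpow_natCast]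
    refine ENNReal.div_le_of_le_mul (h.trans (le_of_eq ?_))
    rw [← mul_assoc, ← ENNReal.ofReal_mul (by positivity), div_mul_cancel₀ _ hrn.ne']
  have h2 : g a ≤ κ / r ^ s := by
    have := (ENNReal.rpow_le_rpow_iff hp).1 key
    exact (ENNReal.ofReal_le_ofReal_iff (by positivity)).1 this
  rwa [le_div_iff₀ hrs, mul_comm] at h2

/-- Chaining along shrinking balls: if `g` has small mass on all balls `B(x, 4r/2^j)`, then the
value `U a` at a good point is close to the constant value of `U` near `x`. -/
theorem abs_sub_lt_half_of_small_mass {n : ℕ} {p s θ r : ℝ} (hp : 0 < p) (hs0 : 0 < s)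
    (hs1 : s ≤ 1) (hsp : s * p = n) (hr : 0 < r) (hθ : 0 < θ)
    (hθq : 48 * θ ≤ 1 - (1 / 2 : ℝ) ^ (1 / p))
    {U g : EuclideanSpace ℝ (Fin n) → ℝ} (hg : AEMeasurable g volume) (hg0 : ∀ x, 0 ≤ g x)
    {N : Set (EuclideanSpace ℝ (Fin n))} (hN : volume N = 0)
    (hU : ∀ x ∉ N, ∀ y ∉ N, |U x - U y| ≤ dist x y ^ s * (g x + g y))
    {E : Set (EuclideanSpace ℝ (Fin n))} (hE : IsOpen E) {c : ℝ}
    (hUE : ∀ w ∈ E, w ∉ N → U w = c) {x a : EuclideanSpace ℝ (Fin n)} (hx : x ∈ E) (ha : a ∉ N)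
    (hax : dist a x < 4 * r) (hga : (2 * r) ^ s * g a ≤ θ)
    (h : ∀ j : ℕ, ∫⁻ w in Metric.ball x (4 * r * (1 / 2) ^ j), ENNReal.ofReal (g w) ^ p ≤
      ENNReal.ofReal ((θ * ((1 / 2 : ℝ) ^ (1 / p)) ^ j) ^ p) *
        volume (Metric.ball (0 : EuclideanSpace ℝ (Fin n)) 1)) :
    |U a - c| < 1 / 2 := by
  set q : ℝ := (1 / 2 : ℝ) ^ (1 / p) with hq
  have hq0 : 0 < q := by positivity
  have hq1 : q < 1 := by linarith
  have hρ : ∀ j : ℕ, 0 < 4 * r * (1 / 2 : ℝ) ^ j := fun j => by positivity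
  choose y hyB hyN hyg using fun j => exists_rpow_mul_le_of_setLIntegral_ball_le hp hsp (hρ j)
    (by positivity : 0 ≤ θ * q ^ j) hg hN x (h j)
  have h2s : (2 : ℝ) ^ s ≤ 2 := by
    simpa using Real.rpow_le_rpow_of_exponent_le (by norm_num : (1 : ℝ) ≤ 2) hs1
  have h2s0 : (0 : ℝ) < 2 ^ s := by positivity
  -- Each doubling of the radius costs a factor `2 ^ s ≤ 2`: one for the diameter of the ball, one
  -- for passing from the smaller radius to the larger. Hence `2 * (2θ + θ)`, here and in each later
  -- step.
  have step0 : |U a - U (y 0)| ≤ 6 * θ := by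
    have h0 := hyg 0
    simp only [pow_zero, mul_one] at h0
    have hd : dist a (y 0) ≤ 2 * (4 * r) := by
      have h1 := hyB 0
      rw [Metric.mem_ball] at h1
      simp only [pow_zero, mul_one] at h1
      linarith [dist_triangle_right a (y 0) x]
    have hds : dist a (y 0) ^ s ≤ 2 ^ s * (4 * r) ^ s := by
      rw [← Real.mul_rpow (by norm_num) (by positivity)]
      exact Real.rpow_le_rpow dist_nonneg hd hs0.le
    have h4 : (4 * r) ^ s = 2 ^ s * (2 * r) ^ s := by
      rw [← Real.mul_rpow (by norm_num) (by positivity)]; ring_nf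
    have hA : (4 * r) ^ s * g a ≤ 2 * θ := by
      rw [h4, mul_assoc]
      exact mul_le_mul h2s hga (mul_nonneg (by positivity) (hg0 a)) (by norm_num)
    calc |U a - U (y 0)| ≤ dist a (y 0) ^ s * (g a + g (y 0)) := hU _ ha _ (hyN 0)
      _ ≤ (2 ^ s * (4 * r) ^ s) * (g a + g (y 0)) :=
        mul_le_mul_of_nonneg_right hds (add_nonneg (hg0 _) (hg0 _))
      _ = 2 ^ s * ((4 * r) ^ s * g a + (4 * r) ^ s * g (y 0)) := by ring
      _ ≤ 2 * (2 * θ + θ) := mul_le_mul h2s (add_le_add hA h0)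
        (add_nonneg (mul_nonneg (by positivity) (hg0 _)) (mul_nonneg (by positivity) (hg0 _)))
        (by norm_num)
      _ = 6 * θ := by ring
  have step : ∀ j, |U (y j) - U (y (j + 1))| ≤ 6 * θ * q ^ j := by
    intro j
    set ρ := 4 * r * (1 / 2 : ℝ) ^ j with hρdef
    have hρj : 0 < ρ := hρ j
    have hρ' : 4 * r * (1 / 2 : ℝ) ^ (j + 1) = ρ / 2 := by rw [hρdef, pow_succ]; ring
    have hb1 := hyB j
    have hb2 := hyB (j + 1)
    have hg1 := hyg j
    have hg2 := hyg (j + 1)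
    rw [hρ'] at hb2 hg2
    rw [Metric.mem_ball] at hb1 hb2
    have hd : dist (y j) (y (j + 1)) ≤ 2 * ρ := by
      linarith [dist_triangle_right (y j) (y (j + 1)) x]
    have hds : dist (y j) (y (j + 1)) ^ s ≤ 2 ^ s * ρ ^ s := by
      rw [← Real.mul_rpow (by norm_num) hρj.le]
      exact Real.rpow_le_rpow dist_nonneg hd hs0.le
    have h4 : ρ ^ s = 2 ^ s * (ρ / 2) ^ s := by
      rw [← Real.mul_rpow (by norm_num) (by positivity)]; ring_nf
    have hqj : q ^ (j + 1) ≤ q ^ j := pow_le_pow_of_le_one hq0.le hq1.le (Nat.le_succ j)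
    have hA : ρ ^ s * g (y (j + 1)) ≤ 2 * (θ * q ^ j) := by
      rw [h4, mul_assoc]
      exact mul_le_mul h2s (hg2.trans (by gcongr)) (mul_nonneg (by positivity) (hg0 _))
        (by norm_num)
    calc |U (y j) - U (y (j + 1))| ≤ dist (y j) (y (j + 1)) ^ s * (g (y j) + g (y (j + 1))) :=
          hU _ (hyN _) _ (hyN _)
      _ ≤ (2 ^ s * ρ ^ s) * (g (y j) + g (y (j + 1))) :=
        mul_le_mul_of_nonneg_right hds (add_nonneg (hg0 _) (hg0 _))
      _ = 2 ^ s * (ρ ^ s * g (y j) + ρ ^ s * g (y (j + 1))) := by ring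
      _ ≤ 2 * (θ * q ^ j + 2 * (θ * q ^ j)) := mul_le_mul h2s (add_le_add hg1 hA)
        (add_nonneg (mul_nonneg (by positivity) (hg0 _)) (mul_nonneg (by positivity) (hg0 _)))
        (by norm_num)
      _ = 6 * θ * q ^ j := by ring
  -- The geometric sum, multiplied through by `1 - q`. In total `|U a - U (y J)| ≤ 12θ / (1 - q) ≤
  -- 1/4`, which explains the `48`.
  have tele : ∀ J, (1 - q) * |U a - U (y J)| ≤ (1 - q) * (6 * θ) + 6 * θ * (1 - q ^ J) := by
    intro J
    induction J with
    | zero => simpa using mul_le_mul_of_nonneg_left step0 (by linarith : 0 ≤ 1 - q)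
    | succ J ih =>
      have h1 : |U a - U (y (J + 1))| ≤ |U a - U (y J)| + 6 * θ * q ^ J :=
        (abs_sub_le _ (U (y J)) _).trans (add_le_add_right (step J) _)
      have h2 := mul_le_mul_of_nonneg_left h1 (by linarith : 0 ≤ 1 - q)
      rw [pow_succ]
      nlinarith
  -- Since `E` is open, the chain reaches it after finitely many steps, so no limit or Lebesgue
  -- point is needed.
  obtain ⟨ε, hε, hεE⟩ := Metric.isOpen_iff.1 hE x hx
  obtain ⟨J, hJ⟩ := exists_pow_lt_of_lt_one (by positivity : 0 < ε / (4 * r))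
    (by norm_num : (1 / 2 : ℝ) < 1)
  have hyE : y J ∈ E := by
    apply hεE
    refine Metric.ball_subset_ball ?_ (hyB J)
    rw [lt_div_iff₀ (by positivity)] at hJ
    linarith
  have hJ2 := tele J
  rw [hUE _ hyE (hyN J)] at hJ2
  have hqJ : 0 < q ^ J := by positivity
  have h1 : 0 < 1 - q := by linarith
  by_contra hcon
  push Not at hcon
  nlinarith [mul_le_mul_of_nonneg_left hcon h1.le, mul_pos hθ hqJ, mul_pos hθ hq0]

/-- The map `w ↦ dist w z` is 1-Lipschitz, so the fivefold enlargements of a disjoint Vitali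
subfamily project to intervals of length `10 * ρ b` covering `(r, 2r)`. Disjointness lets the masses
be summed. -/
theorem ofReal_le_mul_measure_univ_of_forall_closedBall {X : Type*} [PseudoMetricSpace X]
    [TopologicalSpace.SeparableSpace X] [MeasurableSpace X] [OpensMeasurableSpace X]
    (ν : Measure X) {E : Set X} {z : X} {r R : ℝ} {κ : ℝ≥0∞} (ρ : X → ℝ)
    (hρ0 : ∀ x ∈ E, 0 < ρ x) (hρR : ∀ x ∈ E, ρ x ≤ R)
    (hρ : ∀ x ∈ E, ENNReal.ofReal (ρ x) ≤ κ * ν (Metric.closedBall x (ρ x)))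
    (hE : ∀ t ∈ Set.Ioo r (2 * r), ∃ w ∈ E, dist w z = t) :
    ENNReal.ofReal r ≤ 10 * κ * ν Set.univ := by
  obtain ⟨u, huE, hdisj, hcov⟩ := Vitali.exists_disjoint_subfamily_covering_enlargement_closedBall
    E (fun x => x) ρ R hρR 5 (by norm_num)
  have hcount : u.Countable := by
    refine hdisj.countable_of_nonempty_interior fun a ha => ⟨a, ?_⟩
    exact Metric.ball_subset_interior_closedBall (Metric.mem_ball_self (hρ0 a (huE ha)))
  have hsub : Set.Ioo r (2 * r) ⊆ ⋃ b ∈ u, Metric.closedBall (dist b z) (5 * ρ b) := by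
    intro t ht
    obtain ⟨w, hw, rfl⟩ := hE t ht
    obtain ⟨b, hb, hwb⟩ := hcov w hw
    refine Set.mem_biUnion hb ?_
    have hw' := hwb (Metric.mem_closedBall_self (hρ0 w hw).le)
    rw [Metric.mem_closedBall] at hw' ⊢
    rw [Real.dist_eq]
    exact (abs_dist_sub_le w b z).trans hw'
  calc ENNReal.ofReal r = volume (Set.Ioo r (2 * r)) := by rw [Real.volume_Ioo]; ring_nf
    _ ≤ volume (⋃ b ∈ u, Metric.closedBall (dist b z) (5 * ρ b)) := measure_mono hsub
    _ ≤ ∑' b : u, volume (Metric.closedBall (dist (b : X) z) (5 * ρ b)) :=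
      measure_biUnion_le _ hcount _
    _ ≤ ∑' b : u, 10 * κ * ν (Metric.closedBall (b : X) (ρ b)) := by
      refine ENNReal.tsum_le_tsum fun b => ?_
      rw [Real.volume_closedBall, ← mul_assoc, ENNReal.ofReal_mul (by norm_num), mul_assoc 10 κ]
      refine mul_le_mul' (le_of_eq ?_) (hρ b (huE b.2))
      norm_num
    _ = 10 * κ * ν (⋃ b ∈ u, Metric.closedBall b (ρ b)) := by
      rw [ENNReal.tsum_mul_left, measure_biUnion hcount hdisj
        fun b _ => Metric.isClosed_closedBall.measurableSet]
    _ ≤ 10 * κ * ν Set.univ := by gcongr; exact Set.subset_univ _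

/-- If the value of `U` at a good point differs from its constant value on `E`, and `E` meets all
spheres `S(z, t)`, `r < t < 2 r`, then the Hajłasz gradient has a definite mass. -/
theorem mass_lower_bound_of_half_le_abs_sub {n : ℕ} {p s θ r : ℝ} (hp : 0 < p) (hs0 : 0 < s)
    (hs1 : s ≤ 1) (hsp : s * p = n) (hr : 0 < r) (hθ : 0 < θ)
    (hθq : 48 * θ ≤ 1 - (1 / 2 : ℝ) ^ (1 / p))
    {U g : EuclideanSpace ℝ (Fin n) → ℝ} (hg : AEMeasurable g volume) (hg0 : ∀ x, 0 ≤ g x)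
    {N : Set (EuclideanSpace ℝ (Fin n))} (hN : volume N = 0)
    (hU : ∀ x ∉ N, ∀ y ∉ N, |U x - U y| ≤ dist x y ^ s * (g x + g y))
    {E : Set (EuclideanSpace ℝ (Fin n))} (hE : IsOpen E) {c : ℝ}
    (hUE : ∀ w ∈ E, w ∉ N → U w = c) {z a : EuclideanSpace ℝ (Fin n)} (ha : a ∉ N)
    (haz : dist a z < 2 * r) (hga : (2 * r) ^ s * g a ≤ θ) (hac : 1 / 2 ≤ |U a - c|)
    (hEz : ∀ t ∈ Set.Ioo r (2 * r), ∃ w ∈ E, dist w z = t) :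
    ENNReal.ofReal (θ ^ p) * volume (Metric.ball (0 : EuclideanSpace ℝ (Fin n)) 1) ≤
      40 * ∫⁻ w, ENNReal.ofReal (g w) ^ p := by
  set A := ENNReal.ofReal (θ ^ p) * volume (Metric.ball (0 : EuclideanSpace ℝ (Fin n)) 1) with hA
  have hA0 : A ≠ 0 := mul_ne_zero (by simpa using Real.rpow_pos_of_pos hθ p)
    (Metric.measure_ball_pos _ _ one_pos).ne'
  have hA1 : A ≠ ∞ := ENNReal.mul_ne_top ENNReal.ofReal_ne_top measure_ball_lt_top.ne
  -- The ratio `(1/2) ^ (1/p)` makes the mass threshold halve together with the radius, which gives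
  -- the linear comparison of mass and radius used in the covering.
  have hpow : ∀ j : ℕ, (θ * ((1 / 2 : ℝ) ^ (1 / p)) ^ j) ^ p = (1 / 2) ^ j * θ ^ p := by
    intro j
    rw [Real.mul_rpow hθ.le (by positivity), ← Real.rpow_natCast, ← Real.rpow_mul (by positivity),
      ← Real.rpow_mul (by positivity), mul_comm, ← Real.rpow_natCast]
    congr 2
    field_simp
  set ν : Measure (EuclideanSpace ℝ (Fin n)) :=
    volume.withDensity fun w => ENNReal.ofReal (g w) ^ p with hν
  have hex : ∀ x, ∃ ρ : ℝ, x ∈ E ∩ Metric.ball z (2 * r) → 0 < ρ ∧ ρ ≤ 4 * r ∧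
      ENNReal.ofReal ρ ≤ ENNReal.ofReal (4 * r) / A * ν (Metric.closedBall x ρ) := by
    intro x
    by_cases hx : x ∈ E ∩ Metric.ball z (2 * r)
    swap
    · exact ⟨0, fun h => absurd h hx⟩
    -- Small mass at every scale would force `|U a - c| < 1/2` by chaining, so some scale carries
    -- large mass.
    obtain ⟨j, hj⟩ : ∃ j : ℕ, ENNReal.ofReal ((θ * ((1 / 2 : ℝ) ^ (1 / p)) ^ j) ^ p) *
        volume (Metric.ball (0 : EuclideanSpace ℝ (Fin n)) 1) <
        ∫⁻ w in Metric.ball x (4 * r * (1 / 2) ^ j), ENNReal.ofReal (g w) ^ p := by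
      by_contra! hcon
      refine hac.not_gt (abs_sub_lt_half_of_small_mass hp hs0 hs1 hsp hr hθ hθq hg hg0 hN hU hE
        hUE hx.1 ha ?_ hga hcon)
      have := hx.2
      rw [Metric.mem_ball] at this
      linarith [dist_triangle_right a x z]
    rw [hpow, ENNReal.ofReal_mul (by positivity), mul_assoc, ← hA] at hj
    refine ⟨4 * r * (1 / 2) ^ j, fun _ => ⟨by positivity, ?_, ?_⟩⟩
    · exact mul_le_of_le_one_right (by positivity) (pow_le_one₀ (by norm_num) (by norm_num))
    · rw [ENNReal.ofReal_mul (by positivity), ENNReal.mul_comm_div]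
      refine mul_le_mul' le_rfl ?_
      rw [ENNReal.le_div_iff_mul_le (Or.inl hA0) (Or.inl hA1)]
      refine hj.le.trans ?_
      rw [hν, withDensity_apply _ Metric.isClosed_closedBall.measurableSet]
      exact lintegral_mono_set Metric.ball_subset_closedBall
  choose ρ hρ using hex
  have hmain := ofReal_le_mul_measure_univ_of_forall_closedBall ν ρ
    (fun x hx => (hρ x hx).1) (fun x hx => (hρ x hx).2.1) (fun x hx => (hρ x hx).2.2)
    (z := z) (r := r) fun t ht => by
      obtain ⟨w, hw, hwt⟩ := hEz t ht
      exact ⟨w, ⟨hw, by rw [Metric.mem_ball, hwt]; exact ht.2⟩, hwt⟩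
  rw [hν, withDensity_apply _ MeasurableSet.univ, Measure.restrict_univ,
    ENNReal.ofReal_mul (by norm_num)] at hmain
  set I := ∫⁻ w, ENNReal.ofReal (g w) ^ p
  have hr0 : ENNReal.ofReal r ≠ 0 := by simpa using hr
  have h40 : (10 : ℝ≥0∞) * (ENNReal.ofReal 4 * ENNReal.ofReal r / A) * I =
      ENNReal.ofReal r * (40 * I / A) := by
    have : ENNReal.ofReal 4 = 4 := by simp
    rw [this, div_eq_mul_inv, div_eq_mul_inv]
    rw [show (40 : ℝ≥0∞) = 10 * 4 by norm_num]
    ring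
  rw [h40] at hmain
  have h1 : 1 ≤ 40 * I / A := by
    rw [← ENNReal.mul_le_mul_iff_right hr0 ENNReal.ofReal_ne_top, mul_one]
    exact hmain
  rwa [ENNReal.le_div_iff_mul_le (Or.inl hA0) (Or.inl hA1), one_mul] at h1

/-- Loewner-type estimate: two open sets that both meet all spheres `S(z, t)`, `r < t < 2 r`, have
capacity bounded below in the critical Hajłasz space. -/
theorem exists_pos_le_lintegral_rpow_gradient {n : ℕ} {p s : ℝ} (hp : 0 < p) (hs0 : 0 < s)
    (hs1 : s ≤ 1) (hsp : s * p = n) :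
    ∃ c : ℝ≥0∞, 0 < c ∧ ∀ (z : EuclideanSpace ℝ (Fin n)) (r : ℝ), 0 < r →
      ∀ U : EuclideanSpace ℝ (Fin n) → ℝ, ∀ g ∈ HajlaszBallGradients Set.univ s U,
      ∀ E F : Set (EuclideanSpace ℝ (Fin n)), IsOpen E → IsOpen F →
      (∀ᵐ w, w ∈ E → U w = 1) → (∀ᵐ w, w ∈ F → U w = 0) →
      (∀ t ∈ Set.Ioo r (2 * r), ∃ w ∈ E, dist w z = t) →
      (∀ t ∈ Set.Ioo r (2 * r), ∃ w ∈ F, dist w z = t) →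
      c ≤ ∫⁻ w, ENNReal.ofReal (g w) ^ p := by
  set q : ℝ := (1 / 2 : ℝ) ^ (1 / p) with hq
  have hq1 : q < 1 := Real.rpow_lt_one (by norm_num) (by norm_num) (by positivity)
  set θ : ℝ := (1 - q) / 48 with hθdef
  have hθ : 0 < θ := by rw [hθdef]; linarith
  set A := ENNReal.ofReal (θ ^ p) * volume (Metric.ball (0 : EuclideanSpace ℝ (Fin n)) 1) with hA
  have hA0 : A ≠ 0 := mul_ne_zero (by simpa using Real.rpow_pos_of_pos hθ p)
    (Metric.measure_ball_pos _ _ one_pos).ne'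
  refine ⟨A / 40, ENNReal.div_pos hA0 (by norm_num), ?_⟩
  rintro z r hr U g ⟨hg, hg0, N, -, hN, hU⟩ E F hE hF hUE hUF hEz hFz
  rw [Measure.restrict_univ] at hg
  replace hg0 : ∀ x, 0 ≤ g x := fun x => hg0 x trivial
  rw [ae_iff] at hUE hUF
  set N' := N ∪ ({w | ¬(w ∈ E → U w = 1)} ∪ {w | ¬(w ∈ F → U w = 0)}) with hN'def
  have hN' : volume N' = 0 := measure_union_null hN (measure_union_null hUE hUF)
  have hU' : ∀ x ∉ N', ∀ y ∉ N', |U x - U y| ≤ dist x y ^ s * (g x + g y) := by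
    intro x hx y hy
    refine hU x ⟨trivial, fun h => hx (Or.inl h)⟩ y ⟨trivial, fun h => hy (Or.inl h)⟩ ?_
    rw [frontier_univ, Metric.infEDist_empty, ENNReal.top_div_of_ne_top (by norm_num)]
    exact edist_lt_top x y
  have hUE' : ∀ w ∈ E, w ∉ N' → U w = 1 := by
    intro w hw hwN
    by_contra hne
    exact hwN (Or.inr (Or.inl fun h => hne (h hw)))
  have hUF' : ∀ w ∈ F, w ∉ N' → U w = 0 := by
    intro w hw hwN
    by_contra hne
    exact hwN (Or.inr (Or.inr fun h => hne (h hw)))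
  refine ENNReal.div_le_of_le_mul' ?_
  by_contra! hcon
  have hsmall : ∫⁻ w in Metric.ball z (2 * r), ENNReal.ofReal (g w) ^ p ≤
      ENNReal.ofReal (θ ^ p) * volume (Metric.ball (0 : EuclideanSpace ℝ (Fin n)) 1) := by
    refine (setLIntegral_le_lintegral _ _).trans (le_trans ?_ hcon.le)
    exact le_mul_of_one_le_left zero_le (by norm_num)
  obtain ⟨a, haB, haN, hga⟩ := exists_rpow_mul_le_of_setLIntegral_ball_le hp hsp
    (by positivity : 0 < 2 * r) hθ.le hg hN' z hsmall
  have hθq : 48 * θ ≤ 1 - (1 / 2 : ℝ) ^ (1 / p) := by rw [hθdef, ← hq]; linarith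
  refine hcon.not_ge ?_
  -- The value `U a` is at distance at least `1/2` from `1` or from `0`; the corresponding set
  -- supplies the mass.
  by_cases h1 : 1 / 2 ≤ |U a - 1|
  · exact mass_lower_bound_of_half_le_abs_sub hp hs0 hs1 hsp hr hθ hθq hg hg0 hN' hU' hE hUE' haN
      haB hga h1 hEz
  · refine mass_lower_bound_of_half_le_abs_sub hp hs0 hs1 hsp hr hθ hθq hg hg0 hN' hU' hF hUF' haN
      haB hga ?_ hFz
    push Not at h1
    have := (abs_lt.1 h1).1
    exact le_abs.2 (Or.inl (by linarith))

/-! ### Logarithmic cutoffs and their energy -/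

/-- Combines `log t ≤ t - 1` at `t = (b / a) ^ s` with subadditivity of the power `s ≤ 1`. -/
theorem log_div_le_rpow_div {s a b : ℝ} (hs0 : 0 < s) (hs1 : s ≤ 1) (ha : 0 < a) (hab : a ≤ b) :
    Real.log (b / a) ≤ (b - a) ^ s / (s * a ^ s) := by
  have hba : 0 < b / a := div_pos (ha.trans_le hab) ha
  have h1 : s * Real.log (b / a) ≤ (b / a) ^ s - 1 := by
    rw [← Real.log_rpow hba]
    exact Real.log_le_sub_one_of_pos (Real.rpow_pos_of_pos hba s)
  have h2 : (b / a) ^ s ≤ 1 + ((b - a) / a) ^ s := by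
    have := Real.rpow_add_le_add_rpow zero_le_one (div_nonneg (sub_nonneg.2 hab) ha.le) hs0.le hs1
    rw [Real.one_rpow] at this
    refine le_trans (le_of_eq ?_) this
    congr 1
    field_simp
    ring
  rw [Real.div_rpow (sub_nonneg.2 hab) ha.le] at h2
  have has : 0 < a ^ s := Real.rpow_pos_of_pos ha s
  rw [le_div_iff₀ (by positivity)]
  have h3 : s * Real.log (b / a) ≤ (b - a) ^ s / a ^ s := by linarith
  rw [le_div_iff₀ has] at h3
  linarith

/-- The distance to `z`, truncated to the interval `[ρ, R]`. -/
noncomputable def clampDist {X : Type*} [PseudoMetricSpace X] (z : X) (ρ R : ℝ) (w : X) : ℝ :=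
  max ρ (min (dist w z) R)

/-- A Hajłasz gradient, up to a constant, of the logarithmic cutoff between `S(z, ρ)` and
`S(z, R)`. -/
noncomputable def logGradient {X : Type*} [PseudoMetricSpace X] (s : ℝ) (z : X) (ρ R : ℝ) (w : X) :
    ℝ :=
  if dist w z < R then 4 / (s * Real.log (R / ρ) * clampDist z ρ R w ^ s) else 0

section LogCutoff

variable {X : Type*} [PseudoMetricSpace X] {s ρ R : ℝ} {z : X}

theorem clampDist_pos (hρ : 0 < ρ) (w : X) : 0 < clampDist z ρ R w :=
  hρ.trans_le (le_max_left _ _)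

theorem clampDist_of_le (hρR : ρ ≤ R) {w : X} (h : R ≤ dist w z) : clampDist z ρ R w = R := by
  rw [clampDist, min_eq_right h, max_eq_right hρR]

theorem clampDist_of_dist_le (hρR : ρ ≤ R) {w : X} (h : dist w z ≤ ρ) : clampDist z ρ R w = ρ := by
  rw [clampDist, min_eq_left (h.trans hρR), max_eq_left h]

theorem clampDist_mono {a b : X} (h : dist a z ≤ dist b z) :
    clampDist z ρ R a ≤ clampDist z ρ R b :=
  max_le_max le_rfl (min_le_min h le_rfl)

theorem le_clampDist (w : X) : ρ ≤ clampDist z ρ R w := le_max_left _ _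

theorem continuous_clampDist : Continuous (clampDist z ρ R) := by
  unfold clampDist
  fun_prop

theorem logGradient_nonneg (hs0 : 0 < s) (hρ : 0 < ρ) (hρR : ρ ≤ R) (w : X) :
    0 ≤ logGradient s z ρ R w := by
  unfold logGradient
  split_ifs
  · have h1 := Real.log_nonneg ((one_le_div hρ).2 hρR)
    have h2 := Real.rpow_pos_of_pos (clampDist_pos (R := R) (z := z) hρ w) s
    positivity
  · exact le_rfl

theorem logGradient_of_le {w : X} (h : R ≤ dist w z) : logGradient s z ρ R w = 0 :=
  if_neg h.not_gt

theorem measurable_logGradient [MeasurableSpace X] [OpensMeasurableSpace X] :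
    Measurable (logGradient s z ρ R) := by
  unfold logGradient
  refine Measurable.ite (measurableSet_lt (by fun_prop) measurable_const) ?_ measurable_const
  exact measurable_const.div ((continuous_clampDist.measurable.pow_const s).const_mul _)

/-- The point nearer to `z` alone controls the difference, with a factor `4` to spare; that slack is
spent in the outer cutoff. -/
theorem abs_log_clampDist_sub_le_of_dist_le (hs0 : 0 < s) (hs1 : s ≤ 1) (hρ : 0 < ρ)
    (hρR : ρ < R) {a b : X} (hab : dist a z ≤ dist b z) :
    |Real.log (clampDist z ρ R a) - Real.log (clampDist z ρ R b)| / Real.log (R / ρ) ≤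
      dist a b ^ s * (logGradient s z ρ R a / 4) := by
  have hL : 0 < Real.log (R / ρ) := Real.log_pos ((one_lt_div hρ).2 hρR)
  rcases le_or_gt R (dist a z) with h | h
  · rw [clampDist_of_le hρR.le h, clampDist_of_le hρR.le (h.trans hab), sub_self, abs_zero, zero_div]
    exact mul_nonneg (by positivity) (div_nonneg (logGradient_nonneg hs0 hρ hρR.le a) (by norm_num))
  · have hma := clampDist_pos (R := R) (z := z) hρ a
    have hmb := clampDist_pos (R := R) (z := z) hρ b
    have hm : clampDist z ρ R a ≤ clampDist z ρ R b := clampDist_mono hab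
    have hd : clampDist z ρ R b - clampDist z ρ R a ≤ dist a b := by
      have h1 := abs_max_sub_max_le_abs (min (dist b z) R) (min (dist a z) R) ρ
      have h2 := abs_min_sub_min_le_max (dist b z) R (dist a z) R
      rw [sub_self, abs_zero, max_eq_left (abs_nonneg _)] at h2
      have h3 := abs_dist_sub_le b a z
      rw [dist_comm a b]
      unfold clampDist
      rw [max_comm ρ, max_comm ρ]
      exact (le_abs_self _).trans (h1.trans (h2.trans h3))
    have h1 := log_div_le_rpow_div hs0 hs1 hma hm
    rw [Real.log_div hmb.ne' hma.ne'] at h1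
    have h2 : Real.log (clampDist z ρ R a) ≤ Real.log (clampDist z ρ R b) :=
      Real.log_le_log hma hm
    rw [abs_sub_comm, abs_of_nonneg (sub_nonneg.2 h2), logGradient, if_pos h]
    have hms := Real.rpow_pos_of_pos hma s
    have h3 : (clampDist z ρ R b - clampDist z ρ R a) ^ s ≤ dist a b ^ s :=
      Real.rpow_le_rpow (sub_nonneg.2 hm) hd hs0.le
    rw [div_le_iff₀ hL]
    refine h1.trans ((div_le_div_of_nonneg_right h3 (by positivity)).trans (le_of_eq ?_))
    field_simp

theorem abs_log_clampDist_sub_le (hs0 : 0 < s) (hs1 : s ≤ 1) (hρ : 0 < ρ) (hρR : ρ < R) (a b : X) :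
    |Real.log (clampDist z ρ R a) - Real.log (clampDist z ρ R b)| / Real.log (R / ρ) ≤
      dist a b ^ s * (logGradient s z ρ R a + logGradient s z ρ R b) := by
  have h0 := logGradient_nonneg (z := z) hs0 hρ hρR.le a
  have h1 := logGradient_nonneg (z := z) hs0 hρ hρR.le b
  rcases le_total (dist a z) (dist b z) with h | h
  · refine (abs_log_clampDist_sub_le_of_dist_le hs0 hs1 hρ hρR h).trans ?_
    gcongr
    linarith
  · rw [abs_sub_comm, dist_comm a b]
    refine (abs_log_clampDist_sub_le_of_dist_le hs0 hs1 hρ hρR h).trans ?_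
    gcongr
    linarith

end LogCutoff

/-- The integrand is scale invariant: the core ball and each of the `K` dyadic annuli contribute at
most `2 ^ n` times the volume of the unit ball. -/
theorem setLIntegral_ball_max_rpow_neg_le {n : ℕ} (z : EuclideanSpace ℝ (Fin n)) {ρ : ℝ}
    (hρ : 0 < ρ) (K : ℕ) :
    ∫⁻ w in Metric.ball z (2 ^ K * ρ), ENNReal.ofReal ((max ρ (dist w z) ^ n)⁻¹) ≤
      (K + 1) * (2 ^ n * volume (Metric.ball (0 : EuclideanSpace ℝ (Fin n)) 1)) := by
  have hB : ∀ r : ℝ, 0 < r → volume (Metric.ball z r) = ENNReal.ofReal (r ^ n) *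
      volume (Metric.ball (0 : EuclideanSpace ℝ (Fin n)) 1) := fun r hr => by
    rw [Measure.addHaar_ball_of_pos _ _ hr, finrank_euclideanSpace_fin]
  set ω := volume (Metric.ball (0 : EuclideanSpace ℝ (Fin n)) 1)
  have key : ∀ t : ℝ, 0 < t → ∀ S : Set (EuclideanSpace ℝ (Fin n)), MeasurableSet S →
      S ⊆ Metric.ball z (2 * t) → (∀ w ∈ S, t ≤ max ρ (dist w z)) →
      ∫⁻ w in S, ENNReal.ofReal ((max ρ (dist w z) ^ n)⁻¹) ≤ 2 ^ n * ω := by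
    intro t ht S hSm hS hSt
    calc ∫⁻ w in S, ENNReal.ofReal ((max ρ (dist w z) ^ n)⁻¹)
        ≤ ∫⁻ w in S, ENNReal.ofReal ((t ^ n)⁻¹) := by
          refine setLIntegral_mono' hSm fun w hw => ENNReal.ofReal_le_ofReal ?_
          have := hSt w hw
          gcongr
      _ = ENNReal.ofReal ((t ^ n)⁻¹) * volume S := setLIntegral_const _ _
      _ ≤ ENNReal.ofReal ((t ^ n)⁻¹) * (ENNReal.ofReal ((2 * t) ^ n) * ω) := by
          rw [← hB _ (by positivity)]
          gcongr
      _ = 2 ^ n * ω := by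
          rw [← mul_assoc, ← ENNReal.ofReal_mul (by positivity), mul_pow, mul_left_comm,
            inv_mul_cancel₀ (by positivity), mul_one, ENNReal.ofReal_pow (by norm_num)]
          norm_num
  induction K with
  | zero =>
    rw [pow_zero, one_mul, Nat.cast_zero, zero_add, one_mul]
    refine key ρ hρ _ measurableSet_ball ?_ fun w _ => le_max_left _ _
    exact Metric.ball_subset_ball (by linarith)
  | succ K ih =>
    have hun : Metric.ball z (2 ^ (K + 1) * ρ) ⊆ Metric.ball z (2 ^ K * ρ) ∪
        (Metric.ball z (2 ^ (K + 1) * ρ) \ Metric.ball z (2 ^ K * ρ)) := by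
      rw [Set.union_sdiff_self]; exact Set.subset_union_right
    refine (lintegral_mono_set hun).trans ((lintegral_union_le _ _ _).trans ?_)
    push_cast
    rw [add_mul _ (1 : ℝ≥0∞), one_mul]
    refine add_le_add ih (key (2 ^ K * ρ) (by positivity) _
      (measurableSet_ball.diff measurableSet_ball) ?_ ?_)
    · rw [show 2 * (2 ^ K * ρ) = 2 ^ (K + 1) * ρ by ring]
      exact Set.sdiff_subset
    · intro w hw
      refine le_max_of_le_right ?_
      simpa [Metric.mem_ball] using hw.2

theorem lintegral_logGradient_rpow_le {n : ℕ} {p s ρ : ℝ} (hp : 0 < p) (hs0 : 0 < s)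
    (hsp : s * p = n) (z : EuclideanSpace ℝ (Fin n)) (hρ : 0 < ρ) (K : ℕ) :
    ∫⁻ w, ENNReal.ofReal (logGradient s z ρ (2 ^ K * ρ) w) ^ p ≤
      ENNReal.ofReal ((4 / (s * (K * Real.log 2))) ^ p * ((K + 1) * 2 ^ n)) *
        volume (Metric.ball (0 : EuclideanSpace ℝ (Fin n)) 1) := by
  have hl2 : 0 < Real.log 2 := Real.log_pos (by norm_num)
  have hL : Real.log (2 ^ K * ρ / ρ) = K * Real.log 2 := by
    rw [mul_div_assoc, div_self hρ.ne', mul_one, Real.log_pow]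
  have hρR : ρ ≤ 2 ^ K * ρ := le_mul_of_one_le_left hρ.le (one_le_pow₀ (by norm_num))
  have hpt : ∀ w, ENNReal.ofReal (logGradient s z ρ (2 ^ K * ρ) w) ^ p =
      (Metric.ball z (2 ^ K * ρ)).indicator (fun w =>
        ENNReal.ofReal ((4 / (s * (K * Real.log 2))) ^ p) *
          ENNReal.ofReal ((max ρ (dist w z) ^ n)⁻¹)) w := by
    intro w
    by_cases hw : dist w z < 2 ^ K * ρ
    · rw [Set.indicator_of_mem (by simpa using hw), logGradient, if_pos hw, hL, clampDist,
        min_eq_left hw.le]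
      have hm : 0 < max ρ (dist w z) := hρ.trans_le (le_max_left _ _)
      rw [ENNReal.ofReal_rpow_of_nonneg (by positivity) hp.le, ← ENNReal.ofReal_mul (by positivity)]
      congr 1
      rw [← div_div, Real.div_rpow (by positivity) (by positivity), ← Real.rpow_mul hm.le, hsp,
        Real.rpow_natCast, div_eq_mul_inv]
    · rw [Set.indicator_of_notMem (by simpa using hw), logGradient, if_neg hw, ENNReal.ofReal_zero,
        ENNReal.zero_rpow_of_pos hp]
  rw [lintegral_congr hpt, lintegral_indicator measurableSet_ball,
    lintegral_const_mul' _ _ ENNReal.ofReal_ne_top, ENNReal.ofReal_mul (by positivity), mul_assoc]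
  refine mul_le_mul' le_rfl ((setLIntegral_ball_max_rpow_neg_le z hρ K).trans (le_of_eq ?_))
  rw [ENNReal.ofReal_mul (by positivity), ENNReal.ofReal_add (by positivity) (by norm_num),
    ENNReal.ofReal_natCast, ENNReal.ofReal_pow (by norm_num), mul_assoc]
  norm_num

/-- Normalising by the logarithm gives `K ^ (-p)` against `K + 1 ≤ 2K` dyadic pieces, and `1 - p <
0`. -/
theorem exists_nat_lintegral_logGradient_rpow_le {n : ℕ} {p s : ℝ} (hp : 1 < p) (hs0 : 0 < s)
    (hsp : s * p = n) {ε : ℝ≥0∞} (hε : 0 < ε) :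
    ∃ K : ℕ, 2 ≤ K ∧ ∀ (z : EuclideanSpace ℝ (Fin n)) (ρ : ℝ), 0 < ρ →
      ∫⁻ w, ENNReal.ofReal (logGradient s z ρ (2 ^ K * ρ) w) ^ p ≤ ε := by
  have hl2 : 0 < Real.log 2 := Real.log_pos (by norm_num)
  set D : ℝ := (4 / (s * Real.log 2)) ^ p * (2 * 2 ^ n)
  have hlim : Filter.Tendsto (fun K : ℕ => ENNReal.ofReal (D * (K : ℝ) ^ (-(p - 1))) *
      volume (Metric.ball (0 : EuclideanSpace ℝ (Fin n)) 1)) Filter.atTop (nhds 0) := by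
    have h1 : Filter.Tendsto (fun K : ℕ => D * (K : ℝ) ^ (-(p - 1))) Filter.atTop (nhds 0) := by
      simpa using ((tendsto_rpow_neg_atTop (by linarith : 0 < p - 1)).comp
        tendsto_natCast_atTop_atTop).const_mul D
    have h2 := ENNReal.tendsto_ofReal h1
    rw [ENNReal.ofReal_zero] at h2
    simpa using ENNReal.Tendsto.mul_const (b := volume (Metric.ball
      (0 : EuclideanSpace ℝ (Fin n)) 1)) h2 (Or.inr measure_ball_lt_top.ne)
  obtain ⟨K, hK, hK1⟩ := ((hlim.eventually (gt_mem_nhds hε)).and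
    (Filter.eventually_ge_atTop 2)).exists
  refine ⟨K, hK1, fun z ρ hρ => ?_⟩
  refine (lintegral_logGradient_rpow_le (by linarith) hs0 hsp z hρ K).trans (le_trans ?_ hK.le)
  refine mul_le_mul' (ENNReal.ofReal_le_ofReal ?_) le_rfl
  have hK1' : (1 : ℝ) ≤ K := by exact_mod_cast one_le_two.trans hK1
  have hK0 : (0 : ℝ) < K := by linarith
  have e1 : (4 / (s * (K * Real.log 2))) ^ p = (4 / (s * Real.log 2)) ^ p * (K : ℝ) ^ (-p) := by
    rw [Real.rpow_neg hK0.le, ← div_eq_mul_inv, ← Real.div_rpow (by positivity) hK0.le]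
    congr 1
    field_simp
  have e2 : (K : ℝ) ^ (-(p - 1)) = (K : ℝ) ^ (-p) * K := by
    rw [show -(p - 1) = -p + 1 by ring, Real.rpow_add hK0, Real.rpow_one]
  rw [e1, e2]
  have hc : 0 < (4 / (s * Real.log 2)) ^ p * (K : ℝ) ^ (-p) * 2 ^ n := by positivity
  calc _ = (4 / (s * Real.log 2)) ^ p * (K : ℝ) ^ (-p) * 2 ^ n * (K + 1) := by ring
    _ ≤ (4 / (s * Real.log 2)) ^ p * (K : ℝ) ^ (-p) * 2 ^ n * (2 * K) := by
      gcongr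
      linarith
    _ = _ := by ring

/-! ### Components of sublevel sets and pairs they split -/

/-- If the component of `x` missed the level `t`, it would lie in `{f < t}`. The rest of `Ω` would
then be covered by the open set `{f > t}` and the other open components, so connectedness would put
`y` in the component of `x`. A general `f` serves both `dist · z` and its negative. -/
theorem exists_mem_pathComponentIn_eq {X : Type*} [TopologicalSpace X]
    [LocallyPathConnectedSpace X] {Ω : Set X} (hΩ : IsOpen Ω) (hc : IsPreconnected Ω) {f : X → ℝ}
    (hf : Continuous f) {R t : ℝ} (htR : t < R) {x y : X} (hx : x ∈ Ω) (hxt : f x < t)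
    (hy : y ∈ Ω) (hxy : ¬ JoinedIn (Ω ∩ {w | f w < R}) x y) :
    ∃ w ∈ pathComponentIn (Ω ∩ {w | f w < R}) x, f w = t := by
  set W := Ω ∩ {w | f w < R} with hW
  have hWo : IsOpen W := hΩ.inter (isOpen_lt hf continuous_const)
  have hxW : x ∈ W := ⟨hx, hxt.trans htR⟩
  have hxV : x ∈ pathComponentIn W x := mem_pathComponentIn_self hxW
  by_contra! hne
  have hlt : ∀ w ∈ pathComponentIn W x, f w < t := by
    intro w hw
    by_contra! hwt
    obtain ⟨v, hv, hvt⟩ := (isPathConnected_pathComponentIn hxW).isConnected.isPreconnected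
      |>.intermediate_value hxV hw hf.continuousOn ⟨hxt.le, hwt⟩
    exact hne v hv hvt
  have hsub : Ω ⊆ pathComponentIn W x := by
    refine hc.subset_left_of_subset_union (hWo.pathComponentIn x)
      (v := {w | t < f w} ∪ ⋃ w ∈ W \ pathComponentIn W x, pathComponentIn W w)
      ((isOpen_lt continuous_const hf).union
        (isOpen_biUnion fun w _ => hWo.pathComponentIn w)) ?_ ?_ ⟨x, hx, hxV⟩
    · rw [Set.disjoint_left]
      rintro v hv (hvt | hv')
      · exact (hlt v hv).not_gt hvt
      · obtain ⟨w, hw, hvw⟩ := Set.mem_iUnion₂.1 hv'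
        exact hw.2 (JoinedIn.trans hv (JoinedIn.symm hvw))
    · intro w hw
      by_cases hwV : w ∈ pathComponentIn W x
      · exact Or.inl hwV
      · rcases lt_or_ge t (f w) with h | h
        · exact Or.inr (Or.inl h)
        · have hwW : w ∈ W := ⟨hw, h.trans_lt htR⟩
          exact Or.inr (Or.inr (Set.mem_biUnion (⟨hwW, hwV⟩ : w ∈ W \ pathComponentIn W x)
            (mem_pathComponentIn_self hwW)))
  exact hxy (hsub hy)

theorem notMem_pathComponentIn_of_mem {X : Type*} [TopologicalSpace X] {W : Set X} {x y w : X}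
    (hxy : ¬ JoinedIn W x y) (hw : w ∈ pathComponentIn W y) : w ∉ pathComponentIn W x :=
  fun h => hxy (JoinedIn.trans h (JoinedIn.symm hw))

theorem ball_subset_of_edist_lt_infEDist_frontier {E : Type*} [NormedAddCommGroup E]
    [NormedSpace ℝ E] {Ω : Set E} (hΩ : IsOpen Ω) {a b : E} (ha : a ∈ Ω)
    (h : edist a b < Metric.infEDist a (frontier Ω) / 2) : Metric.ball a (2 * dist a b) ⊆ Ω := by
  rcases (dist_nonneg (x := a) (y := b)).eq_or_lt with h0 | h0
  · rw [← h0, mul_zero, Metric.ball_zero]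
    exact Set.empty_subset _
  refine (convex_ball a _).isPreconnected.subset_left_of_subset_union hΩ
    (isClosed_closure (s := Ω)).isOpen_compl
    (Set.disjoint_compl_right_iff_subset.2 subset_closure) ?_
    ⟨a, Metric.mem_ball_self (by positivity), ha⟩
  intro v hv
  by_contra hcon
  simp only [Set.mem_union, Set.mem_compl_iff, not_or, not_not] at hcon
  have hvf : v ∈ frontier Ω := by rw [hΩ.frontier_eq]; exact ⟨hcon.2, hcon.1⟩
  rw [ENNReal.lt_div_iff_mul_lt (by simp) (by simp)] at h
  have h1 := h.trans_le (Metric.infEDist_le_edist_of_mem hvf)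
  rw [edist_dist, edist_dist, ← ENNReal.ofReal_ofNat, ← ENNReal.ofReal_mul dist_nonneg] at h1
  have h2 := (ENNReal.ofReal_lt_ofReal_iff_of_nonneg (by positivity)).1 h1
  rw [Metric.mem_ball, dist_comm] at hv
  linarith

/-- The ball inclusion keeps the segment in `Ω`; if it also stayed in `S`, it would join `b` to the
component of `a`. -/
theorem exists_mem_segment_notMem {E : Type*} [NormedAddCommGroup E] [NormedSpace ℝ E]
    {Ω S : Set E} {x a b : E} (ha : a ∈ pathComponentIn (Ω ∩ S) x)
    (hb : b ∉ pathComponentIn (Ω ∩ S) x)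
    (hball : Metric.ball a (2 * dist a b) ⊆ Ω ∨ Metric.ball b (2 * dist a b) ⊆ Ω) :
    ∃ c ∈ segment ℝ a b, c ∉ S := by
  have hab : 0 < dist a b := dist_pos.2 fun h => hb (h ▸ ha)
  have hseg : segment ℝ a b ⊆ Ω := by
    rcases hball with h | h
    · exact ((convex_ball a _).segment_subset (Metric.mem_ball_self (by positivity))
        (by rw [Metric.mem_ball, dist_comm]; linarith)).trans h
    · exact ((convex_ball b _).segment_subset (by rw [Metric.mem_ball]; linarith)
        (Metric.mem_ball_self (by positivity))).trans h
  by_contra! hcon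
  exact hb (JoinedIn.trans ha (JoinedIn.of_segment_subset fun c hc => ⟨hseg hc, hcon c hc⟩))

/-- Only pairs split by `V` need a new estimate. The distance condition concerns the first point of
a pair, which may lie on either side of `V`, hence the disjunction. -/
theorem mem_hajlaszBallGradients_indicator {n : ℕ} {Ω V : Set (EuclideanSpace ℝ (Fin n))}
    (hΩ : IsOpen Ω) {s : ℝ} {φ g : EuclideanSpace ℝ (Fin n) → ℝ} (hg : Measurable g)
    (hg0 : ∀ w, 0 ≤ g w) (hφ : ∀ a b, |φ a - φ b| ≤ dist a b ^ s * (g a + g b))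
    (hcross : ∀ a ∈ V, ∀ b ∈ Ω \ V,
      (Metric.ball a (2 * dist a b) ⊆ Ω ∨ Metric.ball b (2 * dist a b) ⊆ Ω) →
      |φ a| ≤ dist a b ^ s * (g a + g b)) :
    g ∈ HajlaszBallGradients Ω s (V.indicator φ) := by
  refine ⟨hg.aemeasurable, fun w _ => hg0 w, ∅, Set.empty_subset _, measure_empty, ?_⟩
  intro x hx y hy hxy
  have hball := ball_subset_of_edist_lt_infEDist_frontier hΩ hx.1 hxy
  by_cases hxV : x ∈ V <;> by_cases hyV : y ∈ V
  · rw [Set.indicator_of_mem hxV, Set.indicator_of_mem hyV]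
    exact hφ x y
  · rw [Set.indicator_of_mem hxV, Set.indicator_of_notMem hyV, sub_zero]
    exact hcross x hxV y ⟨hy.1, hyV⟩ (Or.inl hball)
  · rw [Set.indicator_of_notMem hxV, Set.indicator_of_mem hyV, zero_sub, abs_neg, dist_comm,
      add_comm]
    rw [dist_comm] at hball
    exact hcross y hyV x ⟨hx.1, hxV⟩ (Or.inr hball)
  · rw [Set.indicator_of_notMem hxV, Set.indicator_of_notMem hyV, sub_zero, abs_zero]
    exact mul_nonneg (Real.rpow_nonneg dist_nonneg s) (add_nonneg (hg0 x) (hg0 y))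

/-! ### Extension contradicts separation by a cutoff of small energy -/

theorem eLpNorm_ofReal_eq_lintegral_rpow {α : Type*} [MeasurableSpace α] {μ : Measure α} {p : ℝ}
    (hp : 0 < p) {g : α → ℝ} (hg0 : ∀ w, 0 ≤ g w) :
    eLpNorm g (ENNReal.ofReal p) μ = (∫⁻ w, ENNReal.ofReal (g w) ^ p ∂μ) ^ (1 / p) := by
  rw [eLpNorm_eq_lintegral_rpow_enorm_toReal (by simpa using hp) ENNReal.ofReal_ne_top,
    ENNReal.toReal_ofReal hp.le]
  simp_rw [Real.enorm_of_nonneg (hg0 _)]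

/-- In an extension domain, a logarithmic cutoff at a sufficiently small modulus cannot separate two
open sets that meet a common range of spheres. -/
theorem IsHajlaszBallExtensionDomain.exists_nat_logGradient_not_separating {n : ℕ} (hn : 2 ≤ n)
    {s : ℝ} (hs0 : 0 < s) (hs1 : s ≤ 1) {Ω : Set (EuclideanSpace ℝ (Fin n))}
    (hext : IsHajlaszBallExtensionDomain Ω s (ENNReal.ofReal ((n : ℝ) / s))) :
    ∃ K : ℕ, 2 ≤ K ∧ ∀ (z : EuclideanSpace ℝ (Fin n)) (ρ r : ℝ), 0 < ρ → 0 < r →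
      ∀ (u : EuclideanSpace ℝ (Fin n) → ℝ), Measurable u →
      logGradient s z ρ (2 ^ K * ρ) ∈ HajlaszBallGradients Ω s u →
      ∀ E ⊆ Ω, ∀ F ⊆ Ω, IsOpen E → IsOpen F → (∀ w ∈ E, u w = 1) → (∀ w ∈ F, u w = 0) →
      (∀ t ∈ Set.Ioo r (2 * r), ∃ w ∈ E, dist w z = t) →
      (∀ t ∈ Set.Ioo r (2 * r), ∃ w ∈ F, dist w z = t) → False := by
  have hn' : (2 : ℝ) ≤ n := by exact_mod_cast hn
  have hsp : s * ((n : ℝ) / s) = n := by field_simp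
  have hp1 : 1 < (n : ℝ) / s := by rw [lt_div_iff₀ hs0]; linarith
  set p := (n : ℝ) / s
  have hp : 0 < p := by linarith
  obtain ⟨⟨hΩ, -⟩, -, C, hC⟩ := hext
  obtain ⟨c, hc, hlow⟩ := exists_pos_le_lintegral_rpow_gradient (n := n) hp hs0 hs1 hsp
  have hcp : c ^ (1 / p) ≠ 0 := (ENNReal.rpow_pos_of_nonneg hc (by positivity)).ne'
  -- A norm at most `δ` on `Ω` yields an extension of norm below `c ^ (1 / p)`, the level excluded
  -- by the lower bound.
  obtain ⟨δ, hδ, hδc⟩ := ENNReal.exists_nnreal_pos_mul_lt (ENNReal.coe_ne_top (r := C)) hcp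
  obtain ⟨K, hK, hup⟩ := exists_nat_lintegral_logGradient_rpow_le (n := n) hp1 hs0 hsp
    (ε := (δ : ℝ≥0∞) ^ p) (ENNReal.rpow_pos (by simpa using hδ) ENNReal.coe_ne_top)
  refine ⟨K, hK, ?_⟩
  intro z ρ r hρ hr u hu hG E hEΩ F hFΩ hE hF hEu hFu hEz hFz
  have hρR : ρ ≤ 2 ^ K * ρ := le_mul_of_one_le_left hρ.le (one_le_pow₀ (by norm_num))
  have hnorm : hajlaszBallNorm Ω s (ENNReal.ofReal p) u ≤ δ := by
    refine (iInf₂_le _ hG).trans ((eLpNorm_mono_measure _ Measure.restrict_le_self).trans ?_)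
    rw [eLpNorm_ofReal_eq_lintegral_rpow hp (logGradient_nonneg hs0 hρ hρR)]
    refine (ENNReal.rpow_le_rpow (hup z ρ hρ) (by positivity)).trans (le_of_eq ?_)
    rw [← ENNReal.rpow_mul, mul_one_div_cancel hp.ne', ENNReal.rpow_one]
  have hrest : hajlaszBallRestrictNorm Ω s (ENNReal.ofReal p) u < c ^ (1 / p) := by
    refine ((hC u ⟨hu.aemeasurable, hnorm.trans_lt ENNReal.coe_lt_top⟩).1.trans ?_).trans_lt hδc
    rw [mul_comm]
    gcongr
  obtain ⟨⟨U, hUm, hUu⟩, hU⟩ := iInf_lt_iff.1 hrest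
  obtain ⟨g, hg'⟩ := iInf_lt_iff.1 hU
  obtain ⟨hg, hgU⟩ := iInf_lt_iff.1 hg'
  rw [Measure.restrict_univ, eLpNorm_ofReal_eq_lintegral_rpow hp fun w => hg.2.1 w trivial,
    ENNReal.rpow_lt_rpow_iff (by positivity)] at hgU
  have hae := (ae_restrict_iff' hΩ.measurableSet).1 hUu
  refine hgU.not_ge (hlow z r hr U g hg E F hE hF ?_ ?_ hEz hFz)
  · filter_upwards [hae] with w hw hwE
    rw [hw (hEΩ hwE), hEu w hwE]
  · filter_upwards [hae] with w hw hwF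
    rw [hw (hFΩ hwF), hFu w hwF]

/-! ### The two test functions -/

/-- A split pair has a point `c` on its segment with `dist c z ≥ R`. There the cutoff and its
gradient both vanish, so the estimate for `(a, c)` implies the one for `(a, b)`. -/
theorem logGradient_mem_gradients_inner {n : ℕ} {s ρ R : ℝ} (hs0 : 0 < s) (hs1 : s ≤ 1)
    (hρ : 0 < ρ) (hρR : ρ < R) {Ω : Set (EuclideanSpace ℝ (Fin n))} (hΩ : IsOpen Ω)
    (z x : EuclideanSpace ℝ (Fin n)) :
    logGradient s z ρ R ∈ HajlaszBallGradients Ω s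
      ((pathComponentIn (Ω ∩ {w | dist w z < R}) x).indicator fun w =>
        (Real.log R - Real.log (clampDist z ρ R w)) / Real.log (R / ρ)) := by
  have hL : 0 < Real.log (R / ρ) := Real.log_pos ((one_lt_div hρ).2 hρR)
  refine mem_hajlaszBallGradients_indicator hΩ measurable_logGradient
    (logGradient_nonneg hs0 hρ hρR.le) (fun a b => ?_) ?_
  · refine le_trans (le_of_eq ?_) (abs_log_clampDist_sub_le hs0 hs1 hρ hρR a b)
    rw [← sub_div, sub_sub_sub_cancel_left, abs_div, abs_of_pos hL, abs_sub_comm]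
  · intro a ha b hb hball
    obtain ⟨c, hc, hcS⟩ := exists_mem_segment_notMem ha hb.2 hball
    have hcR : R ≤ dist c z := not_lt.1 hcS
    have hac : dist a c ≤ dist a b := by
      linarith [dist_add_dist_of_mem_segment hc, dist_nonneg (x := c) (y := b)]
    have h1 := abs_log_clampDist_sub_le (z := z) hs0 hs1 hρ hρR a c
    rw [clampDist_of_le hρR.le hcR, logGradient_of_le hcR, add_zero] at h1
    have ha0 := logGradient_nonneg (z := z) hs0 hρ hρR.le a
    have hb0 := logGradient_nonneg (z := z) hs0 hρ hρR.le b
    rw [abs_div, abs_of_pos hL, abs_sub_comm]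
    refine h1.trans ?_
    have := Real.rpow_le_rpow dist_nonneg hac hs0.le
    gcongr
    linarith

/-- The gradient does not vanish on the ball of radius `ρ`, so the crossing point cannot simply
replace `b`. For `a` within `4 * ρ` of `z`, the gradient at `a` is comparable to `ρ ^ (-s)`, using
the factor `4` in `logGradient`. Farther away, an admissible split pair would force a whole sphere
around `z` into `Ω`. -/
theorem logGradient_mem_gradients_outer {n : ℕ} {s ρ R : ℝ} (hs0 : 0 < s) (hs1 : s ≤ 1)
    (hρ : 0 < ρ) (hρR : 4 * ρ ≤ R) {Ω : Set (EuclideanSpace ℝ (Fin n))} (hΩ : IsOpen Ω)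
    (z x : EuclideanSpace ℝ (Fin n)) (hsphere : ¬ Metric.sphere z (3 / 2 * ρ) ⊆ Ω) :
    logGradient s z ρ R ∈ HajlaszBallGradients Ω s
      ((pathComponentIn (Ω ∩ {w | -dist w z < -ρ}) x).indicator fun w =>
        (Real.log (clampDist z ρ R w) - Real.log ρ) / Real.log (R / ρ)) := by
  have hρR' : ρ < R := by linarith
  have hL : 0 < Real.log (R / ρ) := Real.log_pos ((one_lt_div hρ).2 hρR')
  refine mem_hajlaszBallGradients_indicator hΩ measurable_logGradient
    (logGradient_nonneg hs0 hρ hρR'.le) (fun a b => ?_) ?_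
  · refine le_trans (le_of_eq ?_) (abs_log_clampDist_sub_le hs0 hs1 hρ hρR' a b)
    rw [← sub_div, sub_sub_sub_cancel_right, abs_div, abs_of_pos hL]
  · intro a ha b hb hball
    obtain ⟨c, hc, hcS⟩ := exists_mem_segment_notMem ha hb.2 hball
    have hcρ : dist c z ≤ ρ := by simpa using hcS
    have hac : dist a c ≤ dist a b := by
      linarith [dist_add_dist_of_mem_segment hc, dist_nonneg (x := c) (y := b)]
    have hcb : dist c b ≤ dist a b := by
      linarith [dist_add_dist_of_mem_segment hc, dist_nonneg (x := a) (y := c)]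
    have htri := dist_triangle a c z
    have htri' := dist_triangle b c z
    rw [dist_comm b c] at htri'
    rcases le_or_gt (4 * ρ) (dist a z) with h4 | h4
    -- Here `dist a b ≥ 3ρ`, while points of the sphere lie within `3ρ/2 + ρ + dist a b < 2 * dist a
    -- b` of both `a` and `b`.
    · refine absurd (fun w hw => ?_) hsphere
      rw [Metric.mem_sphere] at hw
      rcases hball with h | h
      · apply h
        rw [Metric.mem_ball]
        linarith [dist_triangle_right w a z]
      · apply h
        rw [Metric.mem_ball]
        linarith [dist_triangle_right w b z]
    · have hb0 := logGradient_nonneg (z := z) hs0 hρ hρR'.le b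
      set m := clampDist z ρ R a with hm
      have hma : m = max ρ (dist a z) := by rw [hm, clampDist, min_eq_left (h4.le.trans hρR)]
      have hm0 : 0 < m := clampDist_pos hρ a
      have hρm : ρ ≤ m := le_clampDist a
      have hm4 : m ≤ 4 * ρ := by rw [hma]; exact max_le (by linarith) h4.le
      have hmd : m - ρ ≤ dist a b := by
        rw [hma, sub_le_iff_le_add]
        exact max_le (by linarith [dist_nonneg (x := a) (y := b)]) (by linarith)
      have h1 := log_div_le_rpow_div hs0 hs1 hρ hρm
      rw [Real.log_div hm0.ne' hρ.ne'] at h1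
      have hlog : Real.log ρ ≤ Real.log m := Real.log_le_log hρ hρm
      have hds : (m - ρ) ^ s ≤ dist a b ^ s := Real.rpow_le_rpow (sub_nonneg.2 hρm) hmd hs0.le
      have hρs : 0 < ρ ^ s := Real.rpow_pos_of_pos hρ s
      have hmρ : 0 < m ^ s := Real.rpow_pos_of_pos hm0 s
      have h4s : m ^ s ≤ 4 * ρ ^ s := by
        refine (Real.rpow_le_rpow hm0.le hm4 hs0.le).trans ?_
        rw [Real.mul_rpow (by norm_num) hρ.le]
        have : (4 : ℝ) ^ s ≤ 4 := by
          simpa using Real.rpow_le_rpow_of_exponent_le (by norm_num : (1 : ℝ) ≤ 4) hs1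
        gcongr
      rw [abs_of_nonneg (div_nonneg (sub_nonneg.2 hlog) hL.le)]
      have hGa : logGradient s z ρ R a = 4 / (s * Real.log (R / ρ) * m ^ s) :=
        if_pos (h4.trans_le hρR)
      have h2 : 1 / ρ ^ s ≤ 4 / m ^ s := by
        rw [div_le_div_iff₀ hρs hmρ]
        linarith
      calc (Real.log m - Real.log ρ) / Real.log (R / ρ)
          ≤ dist a b ^ s / (s * ρ ^ s) / Real.log (R / ρ) := by
            gcongr
            exact h1.trans (by gcongr)
        _ = dist a b ^ s / (s * Real.log (R / ρ)) * (1 / ρ ^ s) := by field_simp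
        _ ≤ dist a b ^ s / (s * Real.log (R / ρ)) * (4 / m ^ s) := by gcongr
        _ = dist a b ^ s * logGradient s z ρ R a := by rw [hGa]; field_simp
        _ ≤ dist a b ^ s * (logGradient s z ρ R a + logGradient s z ρ R b) := by
            gcongr
            linarith

theorem measurable_indicator_comp_log_clampDist {n : ℕ} {V : Set (EuclideanSpace ℝ (Fin n))}
    (hV : IsOpen V) {z : EuclideanSpace ℝ (Fin n)} {ρ R : ℝ} {h : ℝ → ℝ} (hh : Measurable h) :
    Measurable (V.indicator fun w => h (Real.log (clampDist z ρ R w))) :=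
  (hh.comp (Real.measurable_log.comp continuous_clampDist.measurable)).indicator hV.measurableSet

/-! ### Both halves of LLC -/

theorem theorem1p1 (n : ℕ) (hn : 2 ≤ n) (s : ℝ) (hs0 : 0 < s) (hs1 : s ≤ 1)
    (Ω : Set (EuclideanSpace ℝ (Fin n))) (hbdd : Bornology.IsBounded Ω)
    (hext : IsHajlaszBallExtensionDomain Ω s (ENNReal.ofReal ((n : ℝ) / s))) :
    HasLLC Ω := by
  have hΩ : IsOpen Ω := hext.1.1
  have hΩc : IsPreconnected Ω := hext.1.2.isPreconnected
  obtain ⟨K, hK, hsep⟩ := hext.exists_nat_logGradient_not_separating hn hs0 hs1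
  have h4K : (4 : ℝ) ≤ 2 ^ K := by
    calc (4 : ℝ) = 2 ^ 2 := by norm_num
      _ ≤ 2 ^ K := pow_le_pow_right₀ (by norm_num) hK
  have h2K : (0 : ℝ) < 2 ^ K := by positivity
  -- The cutoff runs between `2r` and `2 ^ K * (2r) = r / b` in the first half, and between `br` and
  -- `2 ^ K * (br) = r / 2` in the second; the factor `2` leaves room for the spheres of the lower
  -- bound.
  refine ⟨1 / (2 * 2 ^ K), by positivity, ?_, fun z r hr => ⟨?_, ?_⟩⟩
  · rw [div_le_one (by positivity)]
    linarith
  · rintro x ⟨hxΩ, hxr⟩ y ⟨hyΩ, hyr⟩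
    rw [Metric.mem_ball] at hxr hyr
    set R : ℝ := 2 ^ K * (2 * r) with hR
    have hRr : r / (1 / (2 * 2 ^ K)) = R := by rw [hR]; field_simp
    rw [hRr]
    have hρR : 2 * r < R := by rw [hR]; nlinarith
    by_contra hxy
    replace hxy : ¬ JoinedIn (Ω ∩ {w | dist w z < R}) x y := hxy
    have hL : 0 < Real.log (R / (2 * r)) :=
      Real.log_pos ((one_lt_div (by positivity)).2 hρR)
    have hf : Continuous fun w : EuclideanSpace ℝ (Fin n) => dist w z := by fun_prop
    have hWo : IsOpen (Ω ∩ {w | dist w z < R}) := hΩ.inter (isOpen_lt hf continuous_const)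
    have hVΩ : ∀ v, pathComponentIn (Ω ∩ {w | dist w z < R}) v ⊆ Ω := fun v =>
      pathComponentIn_subset.trans Set.inter_subset_left
    refine hsep z (2 * r) r (by positivity) hr _
      (measurable_indicator_comp_log_clampDist (hWo.pathComponentIn x)
        (h := fun l => (Real.log R - l) / Real.log (R / (2 * r))) (by fun_prop))
      (logGradient_mem_gradients_inner hs0 hs1 (by positivity) hρR hΩ z x)
      (pathComponentIn (Ω ∩ {w | dist w z < R}) x ∩ Metric.ball z (2 * r))
      (Set.inter_subset_left.trans (hVΩ x))
      (pathComponentIn (Ω ∩ {w | dist w z < R}) y) (hVΩ y)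
      ((hWo.pathComponentIn x).inter Metric.isOpen_ball) (hWo.pathComponentIn y) ?_ ?_ ?_ ?_
    · rintro w ⟨hwV, hwr⟩
      rw [Metric.mem_ball] at hwr
      rw [Set.indicator_of_mem hwV, clampDist_of_dist_le hρR.le hwr.le,
        ← Real.log_div (by linarith) (by positivity), div_self hL.ne']
    · intro w hw
      exact Set.indicator_of_notMem (notMem_pathComponentIn_of_mem hxy hw) _
    · intro t ht
      obtain ⟨w, hw, hwt⟩ := exists_mem_pathComponentIn_eq hΩ hΩc hf (ht.2.trans hρR) hxΩ
        (hxr.trans ht.1) hyΩ hxy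
      exact ⟨w, ⟨hw, by rw [Metric.mem_ball, hwt]; exact ht.2⟩, hwt⟩
    · intro t ht
      exact exists_mem_pathComponentIn_eq hΩ hΩc hf (ht.2.trans hρR) hyΩ
        (hyr.trans ht.1) hxΩ fun h => hxy h.symm
  · rintro x ⟨hxΩ, hxr⟩ y ⟨hyΩ, hyr⟩
    rw [Metric.mem_ball, not_lt] at hxr hyr
    set ρ : ℝ := 1 / (2 * 2 ^ K) * r with hρdef
    have hρ : 0 < ρ := by positivity
    have hRr : 2 ^ K * ρ = r / 2 := by rw [hρdef]; field_simp
    have hρR : 4 * ρ ≤ 2 ^ K * ρ := by gcongr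
    have hρR' : ρ < 2 ^ K * ρ := by linarith
    by_contra hnot
    -- Passing to the complement of the closed ball makes the region open; the negated distance
    -- presents it as a sublevel set.
    have hxy : ¬ JoinedIn (Ω ∩ {w | -dist w z < -ρ}) x y := by
      refine fun h => hnot (h.mono fun w hw => ⟨hw.1, fun hwb => ?_⟩)
      rw [Metric.mem_ball] at hwb
      have := hw.2
      rw [Set.mem_ofPred_eq, neg_lt_neg_iff] at this
      linarith
    have hL : 0 < Real.log (2 ^ K * ρ / ρ) := Real.log_pos ((one_lt_div hρ).2 hρR')
    have hf : Continuous fun w : EuclideanSpace ℝ (Fin n) => -dist w z := by fun_prop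
    have hWo : IsOpen (Ω ∩ {w | -dist w z < -ρ}) := hΩ.inter (isOpen_lt hf continuous_const)
    have hVΩ : ∀ v, pathComponentIn (Ω ∩ {w | -dist w z < -ρ}) v ⊆ Ω := fun v =>
      pathComponentIn_subset.trans Set.inter_subset_left
    have hreach : ∀ t, ρ < t → t < r →
        (∃ w ∈ pathComponentIn (Ω ∩ {w | -dist w z < -ρ}) x, dist w z = t) ∧
        ∃ w ∈ pathComponentIn (Ω ∩ {w | -dist w z < -ρ}) y, dist w z = t := by
      intro t ht htr
      obtain ⟨w, hw, hwt⟩ := exists_mem_pathComponentIn_eq hΩ hΩc hf (neg_lt_neg ht) hxΩ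
        (by linarith) hyΩ hxy
      obtain ⟨v, hv, hvt⟩ := exists_mem_pathComponentIn_eq hΩ hΩc hf (neg_lt_neg ht) hyΩ
        (by linarith) hxΩ fun h => hxy h.symm
      exact ⟨⟨w, hw, neg_injective hwt⟩, ⟨v, hv, neg_injective hvt⟩⟩
    -- Both components meet this sphere, which is path connected as `n ≥ 2`; if it lay in `Ω`, it
    -- would join them.
    have hsphere : ¬ Metric.sphere z (3 / 2 * ρ) ⊆ Ω := by
      intro hS
      obtain ⟨⟨w, hw, hwt⟩, ⟨v, hv, hvt⟩⟩ := hreach (3 / 2 * ρ) (by linarith) (by linarith)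
      have hrank : 1 < Module.rank ℝ (EuclideanSpace ℝ (Fin n)) :=
        Module.one_lt_rank_of_one_lt_finrank (by rw [finrank_euclideanSpace_fin]; omega)
      have hwv := (isPathConnected_sphere hrank z (by positivity : 0 ≤ 3 / 2 * ρ)).joinedIn
        w hwt v hvt
      refine hxy ((JoinedIn.trans hw (hwv.mono fun a ha => ⟨hS ha, ?_⟩)).trans (JoinedIn.symm hv))
      rw [Metric.mem_sphere] at ha
      rw [Set.mem_ofPred_eq, ha]
      linarith
    have hopen : IsOpen {w : EuclideanSpace ℝ (Fin n) | r / 2 < dist w z} :=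
      isOpen_lt continuous_const (by fun_prop)
    -- The spheres used have radii in `(r/2, r)`: beyond `r / 2` the cutoff is `1`, and below `r`
    -- both components are known to reach.
    refine hsep z ρ (r / 2) hρ (by positivity) _
      (measurable_indicator_comp_log_clampDist (hWo.pathComponentIn x)
        (h := fun l => (l - Real.log ρ) / Real.log (2 ^ K * ρ / ρ)) (by fun_prop))
      (logGradient_mem_gradients_outer hs0 hs1 hρ hρR hΩ z x hsphere)
      (pathComponentIn (Ω ∩ {w | -dist w z < -ρ}) x ∩ {w | r / 2 < dist w z})
      (Set.inter_subset_left.trans (hVΩ x))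
      (pathComponentIn (Ω ∩ {w | -dist w z < -ρ}) y) (hVΩ y)
      ((hWo.pathComponentIn x).inter hopen) (hWo.pathComponentIn y) ?_ ?_ ?_ ?_
    · rintro w ⟨hwV, hwr⟩
      rw [Set.mem_ofPred_eq, ← hRr] at hwr
      rw [Set.indicator_of_mem hwV, clampDist_of_le hρR'.le hwr.le,
        ← Real.log_div (by positivity) hρ.ne', div_self hL.ne']
    · intro w hw
      exact Set.indicator_of_notMem (notMem_pathComponentIn_of_mem hxy hw) _
    · intro t ht
      obtain ⟨w, hw, hwt⟩ := (hreach t (by linarith [ht.1]) (by linarith [ht.2])).1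
      exact ⟨w, ⟨hw, by rw [Set.mem_ofPred_eq, hwt]; exact ht.1⟩, hwt⟩
    · intro t ht
      exact (hreach t (by linarith [ht.1]) (by linarith [ht.2])).2
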